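/- Let $\mathbf{sSpace}=\mathbf{sSet}^{\Delta^{op}}$ be the category of simplicial spaces with the injective (equivalently, Reedy) model structure: a map is a weak equivalence (resp. cofibration) if it is levelwise a weak homotopy equivalence (resp. monomorphism) of simplicial sets, and a fibration if it has the right lifting property against all maps that are both cofibrations and weak equivalences. A Segal space is a Reedy fibrant simplicial space $X$ whose Segal maps $X_n\to X_1\times_{X_0}\cdots\times_{X_0}X_1$ are weak homotopy equivalences for all $n\ge 2$. For a small category $\mathscr C$, let $N\mathscr C$ be its classifying diagram, the simplicial space with $(N\mathscr C)_m=\mathrm{nerve}(\mathrm{Iso}(\mathscr C^{[m]}))$, where $\mathrm{Iso}$ denotes the maximal subgroupoid. Let $I[n]$ be the groupoid with objects $0,\dots,n$ and a unique morphism between any two objects; these form a cosimplicial groupoid $I[\bullet]$. **Proposition.** Let $X$ be a Segal space. Then the cosimplicial simplicial space $\tilde X\colon [n]\mapsto X\times N(I[n])$, together with the map from $\tilde X$ to the constant cosimplicial object at $X$ given by the projections $X\times N(I[n])\to X$, is a cosimplicial resolution of $X$ in $\mathbf{sSpace}$ with the injective model structure. That is, $\tilde X$ is Reedy cofibrant,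 meaning that for every $n\ge 0$ the latching map $$\operatorname*{colim}_{[k]\hookrightarrow[n],\ k<n} X\times N(I[k])\longrightarrow X\times N(I[n])$$ is a cofibration, and every projection $X\times N(I[n])\to X$ is a weak equivalence. Moreover, every projection $X\times N(I[n])\to X$ is a trivial fibration, i.e. both a fibration and a weak equivalence. -/

import Mathlib

open CategoryTheory Limits Opposite Simplicial HomotopicalAlgebra MonoidalCategory
open CartesianMonoidalCategory
open scoped SSet.modelCategoryQuillen

universe v u

namespace SegalResolution

/-! ### Latching and matching objects over the simplex category -/

/-- The category of proper faces of `n`: its objects are the monomorphisms `k ⟶ n` of the simplex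
category that are not isomorphisms, its morphisms are the maps over `n` (these are automatically
monomorphisms). It is the latching category of the Reedy category `Δ` at `n`, and its opposite
is the matching category of the Reedy category `Δᵒᵖ` at `n`. -/
abbrev ProperFaces (n : SimplexCategory) : Type :=
  ObjectProperty.FullSubcategory (fun f : Over n => Mono f.hom ∧ ¬ IsIso f.hom)

/-- The functor sending a proper face `k ⟶ n` to `k`. -/
abbrev ProperFaces.source (n : SimplexCategory) : ProperFaces n ⥤ SimplexCategory :=
  ObjectProperty.ι _ ⋙ Over.forget n

section Reedy

variable {M : Type u} [Category.{v} M]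

/-- The cocone with point `F n` on the restriction of `F` to the proper faces of `n`. -/
@[simps]
def latchingCocone (F : CosimplicialObject M) (n : SimplexCategory) :
    Cocone (ProperFaces.source n ⋙ F) where
  pt := F.obj n
  ι :=
    { app := fun f => F.map f.obj.hom
      naturality := by
        intro f g φ
        have h : φ.hom.left ≫ g.obj.hom = f.obj.hom := Over.w φ.hom
        change F.map φ.hom.left ≫ F.map g.obj.hom = F.map f.obj.hom ≫ 𝟙 _
        rw [← F.map_comp, h, Category.comp_id] }

/-- The latching map `L_n F ⟶ F n`, where the latching object `L_n F` is the colimit of `F` over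
the proper faces of `n`. -/
noncomputable def latchingMap (F : CosimplicialObject M) (n : SimplexCategory)
    [HasColimit (ProperFaces.source n ⋙ F)] :
    colimit (ProperFaces.source n ⋙ F) ⟶ F.obj n :=
  colimit.desc _ (latchingCocone F n)

/-- A cosimplicial object is Reedy cofibrant if all its latching maps are cofibrations. -/
def IsReedyCofibrant [CategoryWithCofibrations M]
    [∀ n : SimplexCategory, HasColimitsOfShape (ProperFaces n) M]
    (F : CosimplicialObject M) : Prop :=
  ∀ n : SimplexCategory, Cofibration (latchingMap F n)

/-- The map `p` from the cosimplicial object `F` to the constant cosimplicial object at `X` is a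
cosimplicial resolution of `X`: a cofibrant approximation of the constant object for the Reedy
structure on cosimplicial objects, whose weak equivalences are the levelwise ones. -/
structure IsCosimplicialResolution [CategoryWithCofibrations M] [CategoryWithWeakEquivalences M]
    [∀ n : SimplexCategory, HasColimitsOfShape (ProperFaces n) M]
    (X : M) (F : CosimplicialObject M) (p : F ⟶ (CosimplicialObject.const M).obj X) : Prop where
  isReedyCofibrant : IsReedyCofibrant F
  weakEquivalence : ∀ n : SimplexCategory, WeakEquivalence (p.app n)

/-- The cone with point `X n` on the restriction of `X` to the proper faces of `n`. -/
@[simps]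
def matchingCone (X : SimplicialObject M) (n : SimplexCategory) :
    Cone ((ProperFaces.source n).op ⋙ X) where
  pt := X.obj (op n)
  π :=
    { app := fun f => X.map f.unop.obj.hom.op
      naturality := by
        intro f g φ
        have h : φ.unop.hom.left ≫ f.unop.obj.hom = g.unop.obj.hom := Over.w φ.unop.hom
        change 𝟙 _ ≫ X.map g.unop.obj.hom.op =
          X.map f.unop.obj.hom.op ≫ X.map φ.unop.hom.left.op
        rw [← X.map_comp, ← op_comp, h, Category.id_comp] }

/-- The matching map `X n ⟶ M_n X`, where the matching object `M_n X` is the limit of `X` over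
the proper faces of `n`. -/
noncomputable def matchingMap (X : SimplicialObject M) (n : SimplexCategory)
    [HasLimit ((ProperFaces.source n).op ⋙ X)] :
    X.obj (op n) ⟶ limit ((ProperFaces.source n).op ⋙ X) :=
  limit.lift _ (matchingCone X n)

/-- A simplicial object is Reedy fibrant if all its matching maps are fibrations. -/
def IsReedyFibrant [CategoryWithFibrations M]
    [∀ n : SimplexCategory, HasLimitsOfShape (ProperFaces n)ᵒᵖ M]
    (X : SimplicialObject M) : Prop :=
  ∀ n : SimplexCategory, Fibration (matchingMap X n)

/-! ### Segal maps -/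

variable [HasFiniteProducts M] [HasEqualizers M]

/-- The iterated fibre product `X₁ ×_{X₀} ⋯ ×_{X₀} X₁` with `n + 1` factors: the part of
`X₁ × ⋯ × X₁` on which the target of each factor is the source of the next one. -/
noncomputable def spineObj (X : SimplicialObject M) (n : ℕ) : M :=
  equalizer
    (Pi.lift fun i : Fin n => Pi.π (fun _ : Fin (n + 1) => X _⦋1⦌) i.castSucc ≫ X.δ 0)
    (Pi.lift fun i : Fin n => Pi.π (fun _ : Fin (n + 1) => X _⦋1⦌) i.succ ≫ X.δ 1)

/-- The Segal map `X_{n+1} ⟶ X₁ ×_{X₀} ⋯ ×_{X₀} X₁` whose components are induced by the edges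
`i < i + 1`. -/
noncomputable def segalMap (X : SimplicialObject M) (n : ℕ) : X _⦋n + 1⦌ ⟶ spineObj X n :=
  equalizer.lift
    (Pi.lift fun i : Fin (n + 1) => X.map (SimplexCategory.mkOfSucc i).op)
    (by
      apply Pi.hom_ext
      intro i
      simp only [Category.assoc, Pi.lift_π, Pi.lift_π_assoc, SimplicialObject.δ_def,
        ← Functor.map_comp, ← op_comp]
      rw [SimplexCategory.δ_zero_mkOfSucc, SimplexCategory.δ_one_mkOfSucc, Fin.succ_castSucc])

end Reedy

/-! ### Weak homotopy equivalences of simplicial sets -/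

/-- Homotopy classes of maps `X ⟶ K` of simplicial sets. -/
def HomotopyClasses (X K : SSet.{u}) : Type u :=
  Quot (fun f g : X ⟶ K => Nonempty (SSet.Homotopy f g))

/-- Precomposition with `f` on homotopy classes of maps. -/
def HomotopyClasses.precomp {X Y : SSet.{u}} (f : X ⟶ Y) (K : SSet.{u}) :
    HomotopyClasses Y K → HomotopyClasses X K :=
  Quot.map (fun g => f ≫ g) (by
    rintro g₀ g₁ ⟨H⟩
    exact ⟨SSet.RelativeMorphism.Homotopy.precomp H (SSet.RelativeMorphism.botEquiv.symm f)
      (SSet.Subcomplex.isInitialBot.hom_ext _ _)⟩)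

/-- A map `f : X ⟶ Y` of simplicial sets is a weak homotopy equivalence if, for every Kan complex
`K`, precomposition with `f` is a bijection on homotopy classes of maps to `K`. -/
def IsWeakHomotopyEquivalence {X Y : SSet.{u}} (f : X ⟶ Y) : Prop :=
  ∀ (K : SSet.{u}) [SSet.KanComplex K], Function.Bijective (HomotopyClasses.precomp f K)

/-! ### The injective model structure on simplicial spaces -/

/-- Simplicial spaces: simplicial objects in simplicial sets. -/
abbrev SimplicialSpace : Type (u + 1) := SimplicialObject SSet.{u}

/-- Cofibrations are the levelwise monomorphisms. -/
instance : CategoryWithCofibrations SimplicialSpace.{u} where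
  cofibrations := fun _ _ f => ∀ n, Mono (f.app n)

/-- Weak equivalences are the levelwise weak homotopy equivalences. -/
instance : CategoryWithWeakEquivalences SimplicialSpace.{u} where
  weakEquivalences := fun _ _ f => ∀ n, IsWeakHomotopyEquivalence (f.app n)

/-- Fibrations are the maps with the right lifting property against trivial cofibrations. -/
instance : CategoryWithFibrations SimplicialSpace.{u} where
  fibrations := (trivialCofibrations SimplicialSpace.{u}).rlp

/-- A Segal space is a Reedy fibrant simplicial space (with respect to Kan fibrations of simplicial
sets) whose Segal maps `X_n ⟶ X₁ ×_{X₀} ⋯ ×_{X₀} X₁`, `n ≥ 2`, are weak homotopy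
equivalences. -/
structure IsSegalSpace (X : SimplicialSpace.{u}) : Prop where
  isReedyFibrant : IsReedyFibrant X
  segal : ∀ n : ℕ, 1 ≤ n → IsWeakHomotopyEquivalence (segalMap X n)

/-! ### The classifying diagram and the resolution -/

/-- The classifying diagram of a category `C`: the simplicial space which in degree `m` is the
nerve of the maximal subgroupoid of the category of functors `[m] ⥤ C`. -/
def classifyingDiagramObj (C : Type u) [Category.{v} C] : SimplicialSpace.{max u v} where
  obj m := nerve (Core (Fin (m.unop.len + 1) ⥤ C))
  map f := nerveMap
    (((Functor.whiskeringLeft _ _ C).obj f.unop.toOrderHom.monotone.functor).core)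
  map_id _ := rfl
  map_comp _ _ := rfl

/-- The classifying diagram functor. -/
def classifyingDiagram : Cat.{v, u} ⥤ SimplicialSpace.{max u v} where
  obj C := classifyingDiagramObj C
  map F :=
    { app := fun _ => nerveMap (((Functor.whiskeringRight _ _ _).obj F.toFunctor).core)
      naturality := fun _ _ _ => rfl }
  map_id _ := rfl
  map_comp _ _ := rfl

/-- The cosimplicial groupoid `I[n]`, with objects `0, …, n` and a unique morphism between any two
objects (the set of objects is lifted to the universe `u`). -/
def walkingIsos : CosimplicialObject Cat.{0, u} where
  obj n := Cat.of (Codiscrete (ULift.{u} (Fin (n.len + 1))))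
  map f := (Codiscrete.functorOfFun
    (fun i => ULift.up (f.toOrderHom i.down))).toCatHom
  map_id _ := rfl
  map_comp _ _ := rfl

/-- The cosimplicial simplicial space `[n] ↦ X × N(I[n])`. -/
noncomputable def resolution (X : SimplicialSpace.{u}) : CosimplicialObject SimplicialSpace.{u} :=
  (walkingIsos.{u} ⋙ classifyingDiagram.{0, u}) ⋙ tensorLeft X

/-- The map from `[n] ↦ X × N(I[n])` to the constant cosimplicial object at `X` given by the
projections `X × N(I[n]) ⟶ X`. -/
noncomputable def resolutionProj (X : SimplicialSpace.{u}) :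
    resolution X ⟶ (CosimplicialObject.const SimplicialSpace.{u}).obj X where
  app n := fst X (classifyingDiagram.{0, u}.obj (walkingIsos.{u}.obj n))
  naturality := by
    intro m n f
    exact (whiskerLeft_fst X _).trans (Category.comp_id _).symm

end SegalResolution

/-! Since `I[n]` has exactly one morphism between any two objects, an `(m, j)`-bisimplex of
`N(I[n])` is an arbitrary `(j+1) × (m+1)` matrix with entries in `{0, …, n}`, and a map `B ⟶
N(I[n])` is the same as an arbitrary function on the `(0, 0)`-bisimplices of `B`. Everything follows
from this.

Functions extend along injections, so `N(I[n])` has the extension property against all levelwise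
monomorphisms (`exists_extension`), and the projection from `X × N(I[n])` is a fibration. Each level
of `N(I[n])` is the nerve of a nonempty category with unique morphisms, which contracts onto any
vertex, so the projection is also a levelwise homotopy equivalence.

For Reedy cofibrancy, a matrix with entries in the image of a proper face has a canonical
representative, over the face spanned by exactly the entries that occur. Any two representatives are
identified with it in the latching object (`colimit_ι_resolution_eq`), so the latching map is
injective. -/

namespace SegalResolution

/-! ### Maps into the nerve of a category with unique morphisms -/

section Nerve

variable {C : Type u} [Category.{v} C]

/-- A map to the nerve of a thin category is determined by its effect on vertices. -/
lemma hom_nerve_ext [Quiver.IsThin C] {A : SSet.{max u v}} {f g : A ⟶ nerve C}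
    (h : ∀ a : A.obj (op ⦋0⦌), (f.app _ a).obj 0 = (g.app _ a).obj 0) : f = g := by
  refine NatTrans.ext (funext fun m => ConcreteCategory.hom_ext _ _ fun a => ?_)
  induction m using Opposite.rec with
  | op m =>
    refine nerve.ext_of_isThin (funext fun i => ?_)
    have hf := ConcreteCategory.congr_hom (f.naturality (SimplexCategory.const ⦋0⦌ m i).op) a
    have hg := ConcreteCategory.congr_hom (g.naturality (SimplexCategory.const ⦋0⦌ m i).op) a
    have h' := h (A.map (SimplexCategory.const ⦋0⦌ m i).op a)
    exact ((congrArg (fun x => x.obj 0) hf).symm.trans h').trans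
      (congrArg (fun x => x.obj 0) hg)

/-- The map to the nerve of a category with unique morphisms given by a function on vertices. -/
def toNerve [∀ x y : C, Unique (x ⟶ y)] {A : SSet.{max u v}} (r : A.obj (op ⦋0⦌) → C) :
    A ⟶ nerve C where
  app m := ↾fun a =>
    { obj := fun i => r (A.map (SimplexCategory.const ⦋0⦌ m.unop i).op a)
      map := fun _ => default
      map_id := fun _ => Subsingleton.elim _ _
      map_comp := fun _ _ => Subsingleton.elim _ _ }
  naturality m k f := by
    have : Quiver.IsThin C := fun _ _ => inferInstance
    refine ConcreteCategory.hom_ext _ _ fun a => nerve.ext_of_isThin (funext fun i => ?_)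
    change r (A.map _ (A.map f a)) = r (A.map _ a)
    rw [← ConcreteCategory.comp_apply, ← A.map_comp]
    rfl

lemma toNerve_obj_zero [∀ x y : C, Unique (x ⟶ y)] {A : SSet.{max u v}}
    (r : A.obj (op ⦋0⦌) → C) (a : A.obj (op ⦋0⦌)) : ((toNerve r).app _ a).obj 0 = r a := by
  change r (A.map (SimplexCategory.const ⦋0⦌ ⦋0⦌ 0).op a) = r a
  rw [Subsingleton.elim (SimplexCategory.const ⦋0⦌ ⦋0⦌ 0) (𝟙 _)]
  simp

end Nerve

/-- Constructor for homotopies, which leaves out the condition on the empty subcomplex. -/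
def homotopyMk {A B : SSet.{u}} {f g : A ⟶ B} (h : A ⊗ Δ[1] ⟶ B) (h₀ : SSet.ι₀ ≫ h = f)
    (h₁ : SSet.ι₁ ≫ h = g) : SSet.Homotopy f g where
  h := h
  h₀ := h₀
  h₁ := h₁
  rel := NatTrans.ext (funext fun _ => ConcreteCategory.hom_ext _ _ fun a => a.1.2.elim)

/-- A retraction `p` with section `s` such that `p ≫ s` is homotopic to the identity is a weak
homotopy equivalence. -/
lemma isWeakHomotopyEquivalence_of_homotopy {E S : SSet.{u}} (p : E ⟶ S) (s : S ⟶ E)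
    (hs : s ≫ p = 𝟙 S) (H : SSet.Homotopy (𝟙 E) (p ≫ s)) : IsWeakHomotopyEquivalence p := by
  intro K _
  refine ⟨?_, ?_⟩
  · refine Function.LeftInverse.injective (g := HomotopyClasses.precomp s K) ?_
    rintro ⟨g⟩
    change Quot.mk _ (s ≫ p ≫ g) = Quot.mk _ g
    rw [reassoc_of% hs]
  · rintro ⟨g⟩
    refine ⟨Quot.mk _ (s ≫ g), ?_⟩
    -- Composing `H` with `g` gives a homotopy from `g` to `p ≫ s ≫ g`.
    refine (Quot.sound ⟨?_⟩ : Quot.mk _ g = Quot.mk _ (p ≫ s ≫ g)).symm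
    exact homotopyMk (H.h ≫ g) (by rw [H.h₀_assoc, Category.id_comp])
      (by rw [H.h₁_assoc, Category.assoc])

lemma isWeakHomotopyEquivalence_fst_nerve (S : SSet.{max u v}) (C : Type u) [Category.{v} C]
    [∀ x y : C, Unique (x ⟶ y)] [Nonempty C] :
    IsWeakHomotopyEquivalence (fst S (nerve C)) := by
  classical
  have : Quiver.IsThin C := fun _ _ => inferInstance
  let c : C := Classical.arbitrary C
  refine isWeakHomotopyEquivalence_of_homotopy _ (lift (𝟙 S) (toNerve.{v, u} (C := C) fun _ => c)) (by simp) ?_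
  -- The contraction onto `c`: keep the vertex at the end `0` of `Δ[1]` and send it to `c` at the
  -- end `1`. No compatibility is needed, as any function on vertices extends.
  let r (a : ((S ⊗ nerve C) ⊗ Δ[1]).obj (op ⦋0⦌)) : C := if a.2 0 = 0 then a.1.2.obj 0 else c
  refine homotopyMk (lift (fst _ _ ≫ fst _ _) (toNerve.{v, u} r)) ?_ ?_
  · refine CartesianMonoidalCategory.hom_ext _ _ (by simp) (hom_nerve_ext fun a => ?_)
    exact (toNerve_obj_zero.{v, u} r (SSet.ι₀.app _ a)).trans (if_pos rfl)
  · refine CartesianMonoidalCategory.hom_ext _ _ (by simp) (hom_nerve_ext fun a => ?_)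
    exact (toNerve_obj_zero.{v, u} r (SSet.ι₁.app _ a)).trans (if_neg one_ne_zero)

/-! ### Simplices of the classifying diagram of `I[n]` -/

/-- Any two functors to a codiscrete category are related by exactly one natural isomorphism, so the
results on nerves apply to each level of `N(I[n])`. -/
instance uniqueHomCoreFunctorWalkingIsos (J : Type*) [Category* J] (n : SimplexCategory)
    (x y : Core (J ⥤ walkingIsos.{u}.obj n)) : Unique (x ⟶ y) where
  default := ⟨Codiscrete.natIso⟩
  uniq _ := rfl

instance isThinCoreFunctorWalkingIsos (J : Type*) [Category* J] (n : SimplexCategory) :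
    Quiver.IsThin (Core (J ⥤ walkingIsos.{u}.obj n)) :=
  fun _ _ => inferInstance

instance nonemptyCoreFunctorWalkingIsos (J : Type*) [Category* J] (n : SimplexCategory) :
    Nonempty (Core (J ⥤ walkingIsos.{u}.obj n)) :=
  ⟨⟨Codiscrete.functor fun _ => ULift.up 0⟩⟩

/-- The classifying diagram `N(I[n])`. -/
abbrev walkingIsosDiagram (n : SimplexCategory) : SimplicialSpace.{u} :=
  classifyingDiagram.{0, u}.obj (walkingIsos.{u}.obj n)

section

variable {n : SimplexCategory} {m j : SimplexCategoryᵒᵖ}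

/-- The object of `I[n]` at position `(b, a)` of a bisimplex of `N(I[n])`. -/
def entry (σ : ((walkingIsosDiagram.{u} n).obj m).obj j) (b : Fin (j.unop.len + 1))
    (a : Fin (m.unop.len + 1)) : Fin (n.len + 1) :=
  ((σ.obj b).of.obj a).as.down

/-- The bisimplex of `N(I[n])` with given entries. -/
def ofEntries (r : Fin (j.unop.len + 1) → Fin (m.unop.len + 1) → Fin (n.len + 1)) :
    ((walkingIsosDiagram.{u} n).obj m).obj j where
  obj b := ⟨Codiscrete.functor fun a => ULift.up (r b a)⟩
  map _ := ⟨Codiscrete.natIso⟩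
  map_id _ := rfl
  map_comp _ _ := rfl

lemma entry_injective {σ τ : ((walkingIsosDiagram.{u} n).obj m).obj j}
    (h : entry σ = entry τ) : σ = τ := by
  refine nerve.ext_of_isThin (funext fun b => ?_)
  have h' : ∀ F G : Core (Fin (m.unop.len + 1) ⥤ walkingIsos.{u}.obj n),
      (∀ a, (F.of.obj a).as.down = (G.of.obj a).as.down) → F = G := by
    rintro ⟨F⟩ ⟨G⟩ hFG
    refine congrArg Core.mk (CategoryTheory.Functor.ext (fun a => ?_) fun _ _ _ => rfl)
    exact Codiscrete.ext (ULift.ext _ _ (hFG a))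
  exact h' _ _ fun a => congrFun (congrFun h b) a

end

/-- Every function on `(0, 0)`-bisimplices extends to a map to `N(I[n])`. -/
lemma exists_hom_walkingIsosDiagram (n : SimplexCategory) (B : SimplicialSpace.{u})
    (r : (B.obj (op ⦋0⦌)).obj (op ⦋0⦌) → Fin (n.len + 1)) :
    ∃ φ : B ⟶ walkingIsosDiagram.{u} n, ∀ b, entry ((φ.app (op ⦋0⦌)).app (op ⦋0⦌) b) 0 0 = r b := by
  -- `s` spreads `r` over the vertices in the simplicial-space direction; `toNerve` then does so in
  -- the other direction.
  let s (m : SimplexCategoryᵒᵖ) (b : (B.obj m).obj (op ⦋0⦌)) :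
      Core (Fin (m.unop.len + 1) ⥤ walkingIsos.{u}.obj n) :=
    ⟨Codiscrete.functor fun a =>
      ULift.up (r ((B.map (SimplexCategory.const ⦋0⦌ m.unop a).op).app _ b))⟩
  refine ⟨{ app := fun m => toNerve (s m), naturality := fun m k f => ?_ }, fun b => ?_⟩
  · refine hom_nerve_ext fun b => ?_
    refine (toNerve_obj_zero (s k) _).trans (Eq.trans ?_ (congrArg
      (((Functor.whiskeringLeft _ _ _).obj f.unop.toOrderHom.monotone.functor).core).obj
        (toNerve_obj_zero (s m) b).symm))
    refine congrArg (fun t => Core.mk (Codiscrete.functor t)) (funext fun a => ?_)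
    refine congrArg (fun t => ULift.up (r t)) ?_
    exact (ConcreteCategory.congr_hom (congrArg
      (fun t : B.obj m ⟶ B.obj (op ⦋0⦌) => t.app (op ⦋0⦌)) (B.map_comp f (SimplexCategory.const ⦋0⦌ k.unop a).op)) b).symm
  · refine (congrArg (fun t : Core (Fin 1 ⥤ walkingIsos.{u}.obj n) => (t.of.obj 0).as.down)
      (toNerve_obj_zero (s (op ⦋0⦌)) b)).trans (congrArg r ?_)
    rw [Subsingleton.elim (SimplexCategory.const ⦋0⦌ _ 0) (𝟙 ⦋0⦌)]
    simp

/-- Naturality along the vertex inclusions in both directions reduces each matrix entry to a `(0,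
0)`-bisimplex. -/
lemma entry_hom_apply {n : SimplexCategory} {B : SimplicialSpace.{u}}
    (φ : B ⟶ walkingIsosDiagram.{u} n) {m j : SimplexCategoryᵒᵖ} (b : (B.obj m).obj j)
    (y : Fin (j.unop.len + 1)) (a : Fin (m.unop.len + 1)) :
    entry ((φ.app m).app j b) y a =
      entry ((φ.app (op ⦋0⦌)).app (op ⦋0⦌) ((B.map (SimplexCategory.const ⦋0⦌ m.unop a).op).app _
        ((B.obj m).map (SimplexCategory.const ⦋0⦌ j.unop y).op b))) 0 0 := by
  have h₁ := ConcreteCategory.congr_hom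
    ((φ.app m).naturality (SimplexCategory.const ⦋0⦌ j.unop y).op) b
  have h₂ := ConcreteCategory.congr_hom (congrArg (fun t => t.app (op ⦋0⦌))
    (φ.naturality (SimplexCategory.const ⦋0⦌ m.unop a).op))
    ((B.obj m).map (SimplexCategory.const ⦋0⦌ j.unop y).op b)
  exact (congrArg (fun t => entry t 0 a) h₁).symm.trans (congrArg (fun t => entry t 0 0) h₂).symm

lemma hom_walkingIsosDiagram_ext {n : SimplexCategory} {B : SimplicialSpace.{u}}
    {φ ψ : B ⟶ walkingIsosDiagram.{u} n}
    (h : ∀ b, entry ((φ.app (op ⦋0⦌)).app (op ⦋0⦌) b) 0 0 =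
      entry ((ψ.app (op ⦋0⦌)).app (op ⦋0⦌) b) 0 0) : φ = ψ := by
  refine NatTrans.ext (funext fun m => NatTrans.ext (funext fun j =>
    ConcreteCategory.hom_ext _ _ fun b => entry_injective (funext fun y => funext fun a => ?_)))
  exact (entry_hom_apply φ b y a).trans ((h _).trans (entry_hom_apply ψ b y a).symm)

/-- Maps to `N(I[n])` extend along monomorphisms. -/
lemma exists_extension {n : SimplexCategory} {A B : SimplicialSpace.{u}} (i : A ⟶ B)
    (hi : ∀ m, Mono (i.app m)) (φ : A ⟶ walkingIsosDiagram.{u} n) :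
    ∃ ψ : B ⟶ walkingIsosDiagram.{u} n, i ≫ ψ = φ := by
  have hinj : Function.Injective ((i.app (op ⦋0⦌)).app (op ⦋0⦌)) := by
    have := hi (op ⦋0⦌)
    exact (mono_iff_injective _).1 inferInstance
  -- The value `0` off the image of `A` is an arbitrary choice.
  obtain ⟨ψ, hψ⟩ := exists_hom_walkingIsosDiagram n B (Function.extend
    ((i.app (op ⦋0⦌)).app (op ⦋0⦌)) (fun a => entry ((φ.app (op ⦋0⦌)).app (op ⦋0⦌) a) 0 0) 0)
  exact ⟨ψ, hom_walkingIsosDiagram_ext fun b => (hψ _).trans (hinj.extend_apply _ _ b)⟩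

lemma weakEquivalence_fst (X : SimplicialSpace.{u}) (n : SimplexCategory) :
    WeakEquivalence (fst X (walkingIsosDiagram.{u} n)) := by
  refine ⟨fun m => ?_⟩
  exact isWeakHomotopyEquivalence_fst_nerve (X.obj m)
    (Core (Fin (m.unop.len + 1) ⥤ walkingIsos.{u}.obj n))

lemma fibration_fst (X : SimplicialSpace.{u}) (n : SimplexCategory) :
    Fibration (fst X (walkingIsosDiagram.{u} n)) := by
  refine ⟨fun A B i hi => ⟨fun {f g} sq => ?_⟩⟩
  -- The square dictates the component of the lift in `X`; the other component only has to extend a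
  -- map along a monomorphism.
  obtain ⟨ψ, hψ⟩ := exists_extension i hi.1 (f ≫ snd _ _)
  refine ⟨⟨⟨lift g ψ, ?_, ?_⟩⟩⟩
  · apply CartesianMonoidalCategory.hom_ext
    · simpa using sq.w.symm
    · simpa using hψ
  · simp

/-! ### The latching maps -/

lemma congr_app_app_apply {A B : SimplicialSpace.{u}} {f g : A ⟶ B} (h : f = g)
    (m j : SimplexCategoryᵒᵖ) (a : (A.obj m).obj j) :
    (f.app m).app j a = (g.app m).app j a := by
  rw [h]

/-- An injective monotone map of linear orders reflects the order, so pointwise preimages form a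
monotone map. -/
lemma exists_hom_of_range_subset {k l n : SimplexCategory} (f : k ⟶ n) [Mono f] (g : l ⟶ n)
    (h : Set.range g.toOrderHom ⊆ Set.range f.toOrderHom) : ∃ φ : l ⟶ k, φ ≫ f = g := by
  have hf : Function.Injective f.toOrderHom := SimplexCategory.mono_iff_injective.1 inferInstance
  have hf' : StrictMono f.toOrderHom := f.toOrderHom.monotone.strictMono_of_injective hf
  choose φ hφ using fun i => h ⟨i, rfl⟩
  refine ⟨SimplexCategory.Hom.mk ⟨φ, fun i j hij => ?_⟩, ?_⟩
  · rw [← hf'.le_iff_le, hφ, hφ]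
    exact g.toOrderHom.monotone hij
  · ext i : 3
    exact hφ i

/-- Every nonempty subset of `[n]` is the range of a monomorphism of the simplex category. -/
lemma exists_mono_range_eq {n : SimplexCategory} (S : Finset (Fin (n.len + 1))) (hS : S.Nonempty) :
    ∃ (l : SimplexCategory) (h : l ⟶ n), Mono h ∧ Set.range h.toOrderHom = S := by
  obtain ⟨l, hl⟩ := Nat.exists_eq_succ_of_ne_zero (Finset.card_ne_zero.2 hS)
  refine ⟨⦋l⦌, SimplexCategory.Hom.mk (S.orderEmbOfFin hl).toOrderHom, ?_, ?_⟩
  · exact SimplexCategory.mono_iff_injective.2 (S.orderEmbOfFin hl).injective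
  · exact S.range_orderEmbOfFin hl

lemma ProperFaces.exists_notMem_range {n : SimplexCategory} (f : ProperFaces n) :
    ∃ x, x ∉ Set.range f.obj.hom.toOrderHom := by
  by_contra! h
  have := f.property.1
  have : Epi f.obj.hom := SimplexCategory.epi_iff_surjective.2 h
  exact f.property.2 (isIso_of_mono_of_epi _)

/-- Bisimplices of the resolution over two proper faces with the same image agree in the
latching object. -/
lemma colimit_ι_resolution_eq (X : SimplicialSpace.{u}) {n : SimplexCategory}
    {m j : SimplexCategoryᵒᵖ} {f g : ProperFaces n} (x : (X.obj m).obj j)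
    (σ : ((walkingIsosDiagram.{u} f.obj.left).obj m).obj j)
    (τ : ((walkingIsosDiagram.{u} g.obj.left).obj m).obj j)
    (h : ∀ b a, f.obj.hom.toOrderHom (entry σ b a) = g.obj.hom.toOrderHom (entry τ b a)) :
    ((colimit.ι (ProperFaces.source n ⋙ resolution X) f).app m).app j (x, σ) =
      ((colimit.ι (ProperFaces.source n ⋙ resolution X) g).app m).app j (x, τ) := by
  classical
  -- `S` is the set of entries of the common image matrix; the face it spans lies in both given
  -- faces.
  let S : Finset (Fin (n.len + 1)) :=
    Finset.univ.image fun p : Fin (j.unop.len + 1) × Fin (m.unop.len + 1) =>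
      f.obj.hom.toOrderHom (entry σ p.1 p.2)
  obtain ⟨l, i, hi, hiS⟩ := exists_mono_range_eq S (Finset.univ_nonempty.image _)
  have hS (b) (a) : f.obj.hom.toOrderHom (entry σ b a) ∈ Set.range i.toOrderHom := by
    rw [hiS]
    exact Finset.mem_coe.2 (Finset.mem_image.2 ⟨(b, a), Finset.mem_univ _, rfl⟩)
  have hSf : Set.range i.toOrderHom ⊆ Set.range f.obj.hom.toOrderHom := by
    intro y hy
    rw [hiS] at hy
    obtain ⟨p, -, rfl⟩ := Finset.mem_image.1 (Finset.mem_coe.1 hy)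
    exact ⟨_, rfl⟩
  have hSg : Set.range i.toOrderHom ⊆ Set.range g.obj.hom.toOrderHom := by
    intro y hy
    rw [hiS] at hy
    obtain ⟨p, -, rfl⟩ := Finset.mem_image.1 (Finset.mem_coe.1 hy)
    exact ⟨_, (h _ _).symm⟩
  obtain ⟨z, hz⟩ := f.exists_notMem_range
  -- This face is proper because it misses the vertex `z` that `f` misses.
  let e : ProperFaces n := ⟨Over.mk i, hi, fun _ => hz (hSf
    ((SimplexCategory.epi_iff_surjective (f := i)).1 (inferInstanceAs (Epi (Over.mk i).hom)) z))⟩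
  choose r hr using hS
  have key : ∀ (f : ProperFaces n) (σ : ((walkingIsosDiagram.{u} f.obj.left).obj m).obj j),
      Set.range i.toOrderHom ⊆ Set.range f.obj.hom.toOrderHom →
      (∀ b a, i.toOrderHom (r b a) = f.obj.hom.toOrderHom (entry σ b a)) →
      ((colimit.ι (ProperFaces.source n ⋙ resolution X) f).app m).app j (x, σ) =
        ((colimit.ι (ProperFaces.source n ⋙ resolution X) e).app m).app j (x, ofEntries r) := by
    intro f σ hf hσ
    have hinj := SimplexCategory.mono_iff_injective.1 f.property.1
    have := f.property.1
    obtain ⟨φ, hφ⟩ := exists_hom_of_range_subset f.obj.hom i hf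
    let ψ : e ⟶ f := ObjectProperty.homMk (Over.homMk φ hφ)
    have hw := congr_app_app_apply
      (colimit.w (ProperFaces.source n ⋙ resolution X) ψ) m j (x, ofEntries r)
    refine Eq.trans ?_ hw
    refine congrArg (((colimit.ι (ProperFaces.source n ⋙ resolution X) f).app m).app j)
      (Prod.ext rfl (entry_injective (funext fun b => funext fun a => hinj ?_)))
    refine (hσ b a).symm.trans ?_
    rw [← hφ]
    rfl
  exact (key f σ hSf hr).trans (key g τ hSg fun b a => (hr b a).trans (h b a)).symm

/-- Every bisimplex of a colimit of simplicial spaces comes from one of the terms. -/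
lemma exists_colimit_ι_app_app_eq {J : Type} [Category.{0} J] (F : J ⥤ SimplicialSpace.{u})
    [HasColimit F] (m j : SimplexCategoryᵒᵖ) (y : ((colimit F).obj m).obj j) :
    ∃ (k : J) (x : ((F.obj k).obj m).obj j), ((colimit.ι F k).app m).app j x = y :=
  Types.jointly_surjective_of_isColimit (isColimitOfPreserves
    ((evaluation _ _).obj m ⋙ (evaluation _ _).obj j) (colimit.isColimit F)) y

/-- The latching maps of the resolution are cofibrations. -/
lemma isReedyCofibrant_resolution (X : SimplicialSpace.{u}) : IsReedyCofibrant (resolution X) := by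
  refine fun n => ⟨fun m => ?_⟩
  have : ∀ j, Mono (((latchingMap (resolution X) n).app m).app j) := by
    intro j
    rw [mono_iff_injective]
    intro y₁ y₂ hy
    obtain ⟨f, ⟨x₁, σ⟩, rfl⟩ := exists_colimit_ι_app_app_eq _ m j y₁
    obtain ⟨g, ⟨x₂, τ⟩, rfl⟩ := exists_colimit_ι_app_app_eq _ m j y₂
    have hf := congr_app_app_apply
      (colimit.ι_desc (latchingCocone (resolution X) n) f) m j (x₁, σ)
    have hg := congr_app_app_apply
      (colimit.ι_desc (latchingCocone (resolution X) n) g) m j (x₂, τ)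
    have h := hf.symm.trans (Eq.trans hy hg)
    -- The factor `X` is constant in the cosimplicial direction, so only the matrices remain to be
    -- compared.
    obtain rfl : x₁ = x₂ := congrArg Prod.fst h
    refine colimit_ι_resolution_eq X x₁ σ τ fun b a => ?_
    exact congrFun (congrFun (congrArg (fun t => entry t.2) h) b) a
  exact NatTrans.mono_of_mono_app _

end SegalResolution

theorem mainTheorem10 (X : SegalResolution.SimplicialSpace.{u})
    (hX : SegalResolution.IsSegalSpace X) :
    SegalResolution.IsCosimplicialResolution X (SegalResolution.resolution X)
      (SegalResolution.resolutionProj X) ∧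
    ∀ n : SimplexCategory,
      HomotopicalAlgebra.trivialFibrations SegalResolution.SimplicialSpace.{u}
        ((SegalResolution.resolutionProj X).app n) :=
  ⟨⟨SegalResolution.isReedyCofibrant_resolution X, SegalResolution.weakEquivalence_fst X⟩,
    fun n => ⟨(SegalResolution.fibration_fst X n).mem,
      (SegalResolution.weakEquivalence_fst X n).mem⟩⟩
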